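/- For a language $L\subseteq\Sigma^*$ over a finite non-empty alphabet $\Sigma$, let $\kappa(L)$ be its quotient complexity, i.e. the number of distinct left quotients $L_w=\{x\in\Sigma^*\mid wx\in L\}$, $w\in\Sigma^*$, and let $L^R$ be its reverse. Star-free languages are those obtained from finite languages by boolean operations (including complement in $\Sigma^*$) and concatenation. For every $n\ge 1$ there is a star-free language $L$ with $\kappa(L)=n$ and $\kappa(L^R)=2^n-1$. More precisely, such an $L$ exists over every finite alphabet $\Sigma$ satisfying $|\Sigma|\ge 1$ if $n=1$, $|\Sigma|\ge 2$ if $n=2$, and $|\Sigma|\ge n-1$ if $n\ge 3$. Moreover, for $n\ge 3$ such an $L$ over the $(n-1)$-letter alphabet $\{a,b,c_3,\dots,c_{n-1}\}$ is the language accepted by the DFA with state set $\{1,\dots,n\}$, initial state $1$, the even states as accepting states, and transitions $\delta(i,a)=i+1$ for $1\le i\le n-1$, $\delta(n,a)=n$; $\delta(i,b)=i-1$ for $2\le i\le n$, $\delta(1,b)=1$; and, for $3\le j\le n-1$, $\delta(j,c_j)=j-1$ and $\delta(i,c_j)=i$ for $i\ne j$. -/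

import Mathlib

/-- The star-free languages over `α`: the smallest class of languages that contains the finite
languages and is closed under the boolean operations (union, intersection, complement) and under
concatenation. -/
inductive IsStarFree {α : Type*} : Language α → Prop
  | finite (L : Language α) (h : Set.Finite {w : List α | w ∈ L}) : IsStarFree L
  | union {K L : Language α} (hK : IsStarFree K) (hL : IsStarFree L) : IsStarFree (K ⊔ L)
  | inter {K L : Language α} (hK : IsStarFree K) (hL : IsStarFree L) : IsStarFree (K ⊓ L)
  | compl {L : Language α} (hL : IsStarFree L) : IsStarFree Lᶜ
  | concat {K L : Language α} (hK : IsStarFree K) (hL : IsStarFree L) : IsStarFree (K * L)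

/-- The quotient complexity `κ(L)`: the number of distinct left quotients
`{x | w ++ x ∈ L}` of `L`, where `w` ranges over all words (`⊤` if there are infinitely many). -/
noncomputable def quotientComplexity {α : Type*} (L : Language α) : ℕ∞ :=
  (Set.range L.leftQuotient).encard

/-- The alphabet `{a, b, c_3, …, c_{n-1}}`. -/
inductive ReversalLetter (n : ℕ) : Type
  | a : ReversalLetter n
  | b : ReversalLetter n
  | c (j : ℕ) (h3 : 3 ≤ j) (hj : j ≤ n - 1) : ReversalLetter n

/-- The DFA with state set `{1, …, n}`, initial state `1`, accepting states the even ones, where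
`a` sends `i` to `i + 1` (and fixes `n`), `b` sends `i` to `i - 1` (and fixes `1`), and `c_j` sends
`j` to `j - 1` and fixes every other state. -/
def reversalDFA (n : ℕ) (hn : 3 ≤ n) : DFA (ReversalLetter n) (Set.Icc 1 n) where
  step i x :=
    match x with
    | .a => if h : i.1 = n then i else ⟨i.1 + 1, by have := i.2.1; have := i.2.2; grind⟩
    | .b => if h : i.1 = 1 then i else ⟨i.1 - 1, by have := i.2.1; have := i.2.2; grind⟩
    | .c j h3 hj => if i.1 = j then ⟨j - 1, by grind⟩ else i
  start := ⟨1, by grind⟩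
  accept := {i | Even i.1}

/-! When all states of a DFA are reachable, the quotients of the reversed language correspond to the
sets of states from which some fixed word is accepted, so κ(L^R) counts these sets.

In the chain automaton every letter acts monotonically, which has two consequences. The language is
star-free: words whose run stays in an interval are described by induction on its length, and
monotonicity lets a run from an end of the interval stand in for the actual run, so no star is
needed (`DFA.isStarFree_accepts_of_monotone`). And the set of odd states never occurs, since a
monotone self-map of the chain cannot reverse every parity.

All other sets occur. Seen as two-colourings of a path, they change under prepending a letter by a
shift or by copying a colour to a neighbour, and a decreasing weight leads every colouring with a
monochromatic edge back to the even states (`coloring_induction`). With so many sets available, any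
two states are separated, whence κ(L) = n. Larger alphabets are mapped onto the given letters. -/

namespace IsStarFree

/-! ### Closure properties of star-free languages. -/

variable {α : Type*}

theorem of_iff {K L : Language α} (hK : IsStarFree K) (h : ∀ w, w ∈ L ↔ w ∈ K) :
    IsStarFree L := by
  have : L = K := Set.ext h
  rwa [this]

theorem empty : IsStarFree {_w : List α | False} :=
  finite _ (Set.finite_empty.subset fun _ h => h)

theorem univ : IsStarFree {_w : List α | True} :=
  of_iff (compl empty) fun _ => by
    change True ↔ ¬ False
    simp

theorem const (p : Prop) : IsStarFree {_w : List α | p} := by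
  by_cases h : p
  · simpa only [h] using univ
  · simpa only [h] using empty

theorem or {p q : List α → Prop} (hp : IsStarFree {w | p w}) (hq : IsStarFree {w | q w}) :
    IsStarFree {w | p w ∨ q w} :=
  union hp hq

theorem and {p q : List α → Prop} (hp : IsStarFree {w | p w}) (hq : IsStarFree {w | q w}) :
    IsStarFree {w | p w ∧ q w} :=
  inter hp hq

theorem not {p : List α → Prop} (hp : IsStarFree {w | p w}) : IsStarFree {w | ¬ p w} :=
  compl hp

theorem append {p q : List α → Prop} (hp : IsStarFree {w | p w}) (hq : IsStarFree {w | q w}) :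
    IsStarFree {w | ∃ u v, w = u ++ v ∧ p u ∧ q v} :=
  of_iff (concat hp hq) fun w => by
    refine Iff.trans ?_ Language.mem_mul.symm
    constructor
    · rintro ⟨u, v, rfl, hu, hv⟩
      exact ⟨u, hu, v, hv, rfl⟩
    · rintro ⟨u, hu, v, hv, rfl⟩
      exact ⟨u, v, rfl, hu, hv⟩

theorem exists_mem_finset {ι : Type*} (s : Finset ι) {p : ι → List α → Prop}
    (hp : ∀ i ∈ s, IsStarFree {w | p i w}) : IsStarFree {w | ∃ i ∈ s, p i w} := by
  classical
  induction s using Finset.induction_on with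
  | empty => simpa using empty
  | insert i s _ ih =>
    have := (hp i (by simp)).or (ih fun k hk => hp k (by simp [hk]))
    simpa using this

theorem exists_cons [Finite α] {p : α → List α → Prop} (hp : ∀ x, IsStarFree {w | p x w}) :
    IsStarFree {w | ∃ x v, w = x :: v ∧ p x v} := by
  cases nonempty_fintype α
  have hx : ∀ x : α, IsStarFree {w : List α | w = [x]} := fun x =>
    finite _ (Set.finite_singleton [x])
  refine of_iff (exists_mem_finset Finset.univ fun x _ => (hx x).append (hp x)) fun w => ?_
  change (∃ x v, w = x :: v ∧ p x v) ↔ ∃ x ∈ Finset.univ, ∃ u v, w = u ++ v ∧ u = [x] ∧ p x v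
  constructor
  · rintro ⟨x, v, rfl, h⟩
    exact ⟨x, by simp, [x], v, rfl, rfl, h⟩
  · rintro ⟨x, -, u, v, rfl, rfl, h⟩
    exact ⟨x, v, rfl, h⟩

end IsStarFree

/-! ### Monotone actions on a chain give star-free languages. -/

section Monotone

variable {α : Type*}

/-- The run of `f` from `i` on a word visits only states in `[l, u)` and ends in `E`. -/
def StaysIn (f : ℕ → α → ℕ) (l u : ℕ) (E : Set ℕ) : ℕ → List α → Prop
  | i, [] => (l ≤ i ∧ i < u) ∧ i ∈ E
  | i, x :: w => (l ≤ i ∧ i < u) ∧ StaysIn f l u E (f i x) w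

/-- The run of `f` from `i` on a word enters `B` after visiting only states in `[l, u)`. -/
def ExitsTo (f : ℕ → α → ℕ) (l u : ℕ) (B : Set ℕ) : ℕ → List α → Prop
  | i, [] => i ∈ B
  | i, x :: w => i ∈ B ∨ ((l ≤ i ∧ i < u) ∧ ExitsTo f l u B (f i x) w)

variable {f : ℕ → α → ℕ} {l u : ℕ} {E B : Set ℕ}

theorem staysIn_iff {i : ℕ} {w : List α} : StaysIn f l u E i w ↔
    (∀ p s, w = p ++ s → l ≤ p.foldl f i ∧ p.foldl f i < u) ∧ w.foldl f i ∈ E := by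
  induction w generalizing i with
  | nil =>
    simp only [StaysIn, List.nil_eq, List.append_eq_nil_iff]
    constructor
    · rintro ⟨h, h'⟩
      exact ⟨by rintro p s ⟨rfl, rfl⟩; exact h, h'⟩
    · rintro ⟨h, h'⟩
      exact ⟨h [] [] ⟨rfl, rfl⟩, h'⟩
  | cons x w ih =>
    simp only [StaysIn, ih]
    constructor
    · rintro ⟨h, h', hE⟩
      refine ⟨fun p s hp => ?_, hE⟩
      cases p with
      | nil => exact h
      | cons y p =>
        obtain ⟨rfl, hp⟩ := List.cons.inj hp
        exact h' p s (by simpa using hp)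
    · rintro ⟨h, hE⟩
      exact ⟨h [] _ rfl, fun p s hp => h (x :: p) s (by simp [hp]), hE⟩

theorem exitsTo_of_mem {i : ℕ} (h : i ∈ B) (w : List α) : ExitsTo f l u B i w := by
  cases w with
  | nil => exact h
  | cons x w => exact .inl h

theorem ExitsTo.exists_append {i : ℕ} {w : List α} (h : ExitsTo f l u B i w) :
    ∃ p s, w = p ++ s ∧ p.foldl f i ∈ B := by
  induction w generalizing i with
  | nil => exact ⟨[], [], rfl, h⟩
  | cons x w ih =>
    rcases h with h | ⟨-, h⟩
    · exact ⟨[], _, rfl, h⟩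
    · obtain ⟨p, s, rfl, hp⟩ := ih h
      exact ⟨x :: p, s, rfl, hp⟩

/-- Cutting at the last state `m` before `B` turns an exit into a stay, one letter and a free
suffix, so exits inherit star-freeness from stays. -/
theorem exitsTo_iff {i : ℕ} {w : List α} : ExitsTo f l u B i w ↔ i ∈ B ∨
    ∃ m ∈ Finset.range u, ∃ q v, w = q ++ v ∧ StaysIn f l u {m} i q ∧
      ∃ y s, v = y :: s ∧ f m y ∈ B := by
  induction w generalizing i with
  | nil =>
    simp only [ExitsTo, List.nil_eq, List.append_eq_nil_iff]
    constructor
    · exact .inl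
    · rintro (h | ⟨m, -, q, v, ⟨rfl, rfl⟩, -, y, s, h, -⟩)
      · exact h
      · cases h
  | cons x w ih =>
    simp only [ExitsTo, ih]
    refine or_congr_right ⟨?_, ?_⟩
    · rintro ⟨h, h' | ⟨m, hm, q, v, rfl, hq, h'⟩⟩
      · exact ⟨i, by simp [h.2], [], _, rfl, ⟨h, rfl⟩, x, w, rfl, h'⟩
      · exact ⟨m, hm, x :: q, v, rfl, ⟨h, hq⟩, h'⟩
    · rintro ⟨m, hm, q, v, hw, hq, y, s, rfl, h'⟩
      cases q with
      | nil =>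
        obtain ⟨rfl, rfl⟩ := List.cons.inj hw
        obtain ⟨h, rfl⟩ := hq
        exact ⟨h, .inl h'⟩
      | cons z q =>
        obtain ⟨rfl, rfl⟩ := List.cons.inj hw
        exact ⟨hq.1, .inr ⟨m, hm, q, _, rfl, hq.2, y, s, rfl, h'⟩⟩

theorem monotone_foldl_apply (hf : ∀ x, Monotone fun i => f i x) (w : List α) :
    Monotone fun i => w.foldl f i := by
  induction w with
  | nil => exact monotone_id
  | cons x w ih => exact ih.comp (hf x)

/-- Ending at `m` means ending below `m + 1` but not below `m`. Thresholds are the targets that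
monotone comparison can handle. -/
theorem isStarFree_staysIn_of_Iio {i : ℕ}
    (h : ∀ j, IsStarFree {w | StaysIn f l u (Set.Iio j) i w}) (E : Set ℕ) :
    IsStarFree {w | StaysIn f l u E i w} := by
  classical
  refine (IsStarFree.exists_mem_finset ((Finset.range u).filter (· ∈ E))
    fun m _ => (h (m + 1)).and (h m).not).of_iff fun w => ?_
  change StaysIn f l u E i w ↔ ∃ m ∈ _, StaysIn f l u _ i w ∧ ¬ StaysIn f l u _ i w
  simp only [staysIn_iff]
  constructor
  · rintro ⟨h, hE⟩
    exact ⟨w.foldl f i, by simp [hE, (h w [] (by simp)).2], ⟨h, by simp⟩, by simp⟩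
  · rintro ⟨m, hm, ⟨h, h1⟩, h2⟩
    have : w.foldl f i = m := by
      have h3 : ¬ w.foldl f i < m := fun h3 => h2 ⟨h, h3⟩
      have h4 : w.foldl f i < m + 1 := h1
      lia
    exact ⟨h, by simpa [this] using (Finset.mem_filter.1 hm).2⟩

theorem isStarFree_exitsTo [Finite α] {i : ℕ}
    (h : ∀ E, IsStarFree {w | StaysIn f l u E i w}) (B : Set ℕ) :
    IsStarFree {w | ExitsTo f l u B i w} := by
  simp only [exitsTo_iff]
  exact (IsStarFree.const _).or <| IsStarFree.exists_mem_finset _ fun m _ =>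
    (h {m}).append <| IsStarFree.exists_cons fun y => IsStarFree.const _

/-- A run leaves `[l, u + 1)` iff some run between visits of the extreme states does. -/
theorem not_staysIn_iff (hf : ∀ x, Monotone fun i => f i x) (hlu : l ≤ u) {i : ℕ} {w : List α} :
    ¬ StaysIn f l (u + 1) Set.univ i w ↔
      (ExitsTo f (l + 1) (u + 1) (Set.Ici (u + 1)) i w ∨ ExitsTo f l u (Set.Iio l) i w) ∨
      ∃ p v, w = p ++ v ∧ True ∧
        ((∃ x s, v = x :: s ∧ ExitsTo f (l + 1) (u + 1) (Set.Ici (u + 1)) (f l x) s) ∨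
          ∃ x s, v = x :: s ∧ ExitsTo f l u (Set.Iio l) (f u x) s) := by
  constructor
  · induction w generalizing i with
    | nil =>
      intro h
      left
      simp only [StaysIn, ExitsTo, Set.mem_univ, Set.mem_Ici, Set.mem_Iio] at h ⊢
      grind
    | cons x w ih =>
      intro h
      by_cases h1 : u + 1 ≤ i
      · exact .inl (.inl (exitsTo_of_mem h1 _))
      by_cases h2 : i < l
      · exact .inl (.inr (exitsTo_of_mem (Set.mem_Iio.2 h2) _))
      have h3 : ¬ StaysIn f l (u + 1) Set.univ (f i x) w :=
        fun h' => h ⟨⟨by lia, by lia⟩, h'⟩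
      rcases ih h3 with (h4 | h4) | ⟨p, v, rfl, h4⟩
      · by_cases hi : i = l
        · subst hi
          exact .inr ⟨[], _, rfl, trivial, .inl ⟨x, w, rfl, h4⟩⟩
        · exact .inl (.inl (.inr ⟨by lia, h4⟩))
      · by_cases hi : i = u
        · subst hi
          exact .inr ⟨[], _, rfl, trivial, .inr ⟨x, w, rfl, h4⟩⟩
        · exact .inl (.inr (.inr ⟨by lia, h4⟩))
      · exact .inr ⟨x :: p, v, rfl, h4⟩
  · intro h hs
    rw [staysIn_iff] at hs
    replace hs := hs.1
    rcases h with (h | h) | ⟨q, v, rfl, -, ⟨x, s, rfl, h⟩ | ⟨x, s, rfl, h⟩⟩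
    · obtain ⟨p, s, rfl, hp⟩ := h.exists_append
      have := hs p s rfl
      simp only [Set.mem_Ici] at hp
      lia
    · obtain ⟨p, s, rfl, hp⟩ := h.exists_append
      have := hs p s rfl
      simp only [Set.mem_Iio] at hp
      lia
    · obtain ⟨p, s, rfl, hp⟩ := h.exists_append
      have h1 := hs (q ++ x :: p) s (by simp)
      -- The state after `q` need not be `l`: it is at least `l`, so its run lies above the exiting
      -- run from `l`. Hence the prefix can be left arbitrary.
      have h2 : (x :: p).foldl f l ≤ (x :: p).foldl f (q.foldl f i) :=
        monotone_foldl_apply hf (x :: p) (hs q _ rfl).1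
      simp only [Set.mem_Ici] at hp
      rw [List.foldl_append] at h1
      simp only [List.foldl_cons] at h1 h2
      lia
    · obtain ⟨p, s, rfl, hp⟩ := h.exists_append
      have h1 := hs (q ++ x :: p) s (by simp)
      have h2 : (x :: p).foldl f (q.foldl f i) ≤ (x :: p).foldl f u :=
        monotone_foldl_apply hf (x :: p) (Nat.lt_succ_iff.1 (hs q _ rfl).2)
      simp only [Set.mem_Iio] at hp
      rw [List.foldl_append] at h1
      simp only [List.foldl_cons] at h1 h2
      lia

/-- Cut after the last visit to the top state `u`. Conversely, a run from `u` dominates the actual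
one, so its ending below `j` suffices wherever the cut is made. -/
theorem staysIn_Iio_iff (hf : ∀ x, Monotone fun i => f i x) {i j : ℕ} (hju : j ≤ u)
    {w : List α} : StaysIn f l (u + 1) (Set.Iio j) i w ↔
      StaysIn f l (u + 1) Set.univ i w ∧ (StaysIn f l u (Set.Iio j) i w ∨
        ∃ p v, w = p ++ v ∧ True ∧ ∃ x s, v = x :: s ∧ StaysIn f l u (Set.Iio j) (f u x) s) := by
  constructor
  · intro h
    refine ⟨by rw [staysIn_iff] at h ⊢; exact ⟨h.1, trivial⟩, ?_⟩
    induction w generalizing i with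
    | nil =>
      simp only [StaysIn, Set.mem_Iio] at h ⊢
      left
      lia
    | cons x w ih =>
      obtain ⟨hi, h⟩ := h
      rcases ih h with h' | ⟨p, v, rfl, h'⟩
      · by_cases hu : i = u
        · subst hu
          exact .inr ⟨[], _, rfl, trivial, x, w, rfl, h'⟩
        · exact .inl ⟨by lia, h'⟩
      · exact .inr ⟨x :: p, v, rfl, h'⟩
  · rintro ⟨h, h'⟩
    rw [staysIn_iff] at h ⊢
    refine ⟨h.1, ?_⟩
    rcases h' with h' | ⟨p, v, rfl, -, x, s, rfl, h'⟩
    · exact (staysIn_iff.1 h').2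
    · have h1 := (staysIn_iff.1 h').2
      have h2 : (x :: s).foldl f (p.foldl f i) ≤ (x :: s).foldl f u :=
        monotone_foldl_apply hf (x :: s) (Nat.lt_succ_iff.1 (h.1 p _ rfl).2)
      rw [List.foldl_append]
      exact lt_of_le_of_lt h2 h1

theorem isStarFree_staysIn [Finite α] (hf : ∀ x, Monotone fun i => f i x) (d l i : ℕ)
    (E : Set ℕ) : IsStarFree {w | StaysIn f l (l + d) E i w} := by
  induction d generalizing l i E with
  | zero =>
    refine IsStarFree.empty.of_iff fun w => ?_
    change StaysIn f l (l + 0) E i w ↔ False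
    cases w <;> simp only [StaysIn] <;> grind
  | succ d ih =>
    have hup : ∀ k, IsStarFree
        {w | ExitsTo f (l + 1) (l + d + 1) (Set.Ici (l + d + 1)) k w} := fun k => by
      have := isStarFree_exitsTo (ih (l + 1) k) (Set.Ici (l + d + 1))
      rwa [show l + 1 + d = l + d + 1 by lia] at this
    have hdown : ∀ k, IsStarFree {w | ExitsTo f l (l + d) (Set.Iio l) k w} :=
      fun k => isStarFree_exitsTo (ih l k) _
    have hstay : IsStarFree {w | StaysIn f l (l + d + 1) Set.univ i w} := by
      have := (((hup i).or (hdown i)).or (IsStarFree.univ.append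
        ((IsStarFree.exists_cons fun x => hup (f l x)).or
          (IsStarFree.exists_cons fun x => hdown (f (l + d) x))))).not
      simpa only [← not_staysIn_iff hf (Nat.le_add_right l d), not_not] using this
    refine isStarFree_staysIn_of_Iio (fun j => ?_) E
    by_cases hj : j ≤ l + d
    · have := hstay.and ((ih l i (Set.Iio j)).or (IsStarFree.univ.append
        (IsStarFree.exists_cons fun x => ih l (f (l + d) x) (Set.Iio j))))
      simp only [← staysIn_Iio_iff hf hj] at this
      exact this
    · refine hstay.of_iff fun w => ?_
      change StaysIn f l (l + d + 1) _ i w ↔ StaysIn f l (l + d + 1) _ i w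
      rw [staysIn_iff, staysIn_iff]
      refine and_congr_right fun h => ?_
      have := (h w [] (by simp)).2
      simp only [Set.mem_Iio, Set.mem_univ, iff_true]
      lia

end Monotone

/-- An automaton on a finite chain all of whose letters act monotonically accepts a star-free
language. -/
theorem DFA.isStarFree_accepts_of_monotone {α : Type*} [Finite α] {l u : ℕ} (hlu : l ≤ u)
    (M : DFA α (Set.Icc l u)) (hM : ∀ x, Monotone fun i => M.step i x) :
    IsStarFree M.accepts := by
  -- Clamping to `[l, u]` keeps the extended action monotone on all of `ℕ`.
  set f : ℕ → α → ℕ := fun i x => (M.step (Set.projIcc l u hlu i) x).1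
  have hf : ∀ x, Monotone fun i => f i x := fun x =>
    (Subtype.mono_coe _).comp ((hM x).comp (Set.monotone_projIcc hlu))
  have hrun : ∀ (w : List α) (i : Set.Icc l u), w.foldl f i.1 = (M.evalFrom i w).1 := by
    intro w
    induction w with
    | nil => intro i; rfl
    | cons x w ih =>
      intro i
      rw [List.foldl_cons, DFA.evalFrom_cons, ← ih]
      simp only [f, Set.projIcc_val]
  refine (isStarFree_staysIn hf (u + 1 - l) l M.start.1 (Subtype.val '' M.accept)).of_iff
    fun w => ?_
  change M.evalFrom M.start w ∈ M.accept ↔ StaysIn f l (l + (u + 1 - l)) _ M.start.1 w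
  rw [staysIn_iff, hrun, Subtype.val_injective.mem_set_image]
  refine ⟨fun h => ⟨fun p s _ => ?_, h⟩, fun h => h.2⟩
  have := (M.evalFrom M.start p).2
  rw [hrun]
  simp only [Set.mem_Icc] at this
  lia

/-! ### Two-colourings of a path. -/

section Coloring

/-- A weight of a two-colouring of `{0, …, m}` that counts the monochromatic edges
`{i, i + 1}` with coefficients `2 * m - i`. -/
def monochromaticWeight (m : ℕ) (T : ℕ → Bool) : ℕ :=
  ∑ i ∈ Finset.range m, if T i = T (i + 1) then 2 * m - i else 0

theorem eq_decide_odd_or_even {m : ℕ} {T : ℕ → Bool} (h : ∀ i < m, T i ≠ T (i + 1)) :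
    (∀ i ≤ m, T i = decide (i % 2 = 1)) ∨ ∀ i ≤ m, T i = decide (i % 2 = 0) := by
  cases h0 : T 0
  · left
    intro i
    induction i with
    | zero => simp [h0]
    | succ i ih =>
      intro hi
      have := h i (by lia)
      rw [ih (by lia)] at this
      cases h1 : T (i + 1) <;> simp [h1] at this ⊢ <;> lia
  · right
    intro i
    induction i with
    | zero => simp [h0]
    | succ i ih =>
      intro hi
      have := h i (by lia)
      rw [ih (by lia)] at this
      cases h1 : T (i + 1) <;> simp [h1] at this ⊢ <;> lia

/-- The lost edge at `0` has coefficient `2 * m`, which outweighs the gain of at most one for each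
of the `m - 1` shifted edges. -/
theorem monochromaticWeight_shift_left_lt {m : ℕ} {T T' : ℕ → Bool} (hm : 0 < m)
    (h0 : T 0 = T 1) (h : ∀ i < m, T' i = T (i + 1)) (hT : T' m ≠ T m) :
    monochromaticWeight m T' < monochromaticWeight m T := by
  obtain ⟨k, rfl⟩ : ∃ k, m = k + 1 := ⟨m - 1, by lia⟩
  unfold monochromaticWeight
  rw [Finset.sum_range_succ, Finset.sum_range_succ', if_neg, if_pos h0]
  · have : ∑ i ∈ Finset.range k, (if T' i = T' (i + 1) then 2 * (k + 1) - i else 0) ≤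
        ∑ i ∈ Finset.range k,
          ((if T (i + 1) = T (i + 1 + 1) then 2 * (k + 1) - (i + 1) else 0) + 1) := by
      refine Finset.sum_le_sum fun i hi => ?_
      have := Finset.mem_range.1 hi
      rw [h i (by lia), h (i + 1) (by lia)]
      split_ifs <;> lia
    rw [Finset.sum_add_distrib, Finset.sum_const, Finset.card_range] at this
    simp only [smul_eq_mul] at this
    lia
  · rw [h k (by lia)]
    exact hT.symm

theorem monochromaticWeight_shift_right_lt {m : ℕ} {T T' : ℕ → Bool}
    (hm : T m = T (m + 1)) (h : ∀ i ≤ m, T' (i + 1) = T i) (hT : T' 0 ≠ T 0) :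
    monochromaticWeight (m + 1) T' < monochromaticWeight (m + 1) T := by
  unfold monochromaticWeight
  rw [Finset.sum_range_succ', Finset.sum_range_succ, if_neg, if_pos hm]
  · refine Nat.add_lt_add_of_le_of_lt (Finset.sum_le_sum fun i hi => ?_) (by lia)
    have := Finset.mem_range.1 hi
    rw [h i (by lia), h (i + 1) (by lia)]
    split_ifs <;> lia
  · rw [h 0 (by lia)]
    exact hT

/-- The flip moves a monochromatic edge from `p` to `p + 1`, where the coefficient is smaller by
one. -/
theorem monochromaticWeight_flip_lt {m p : ℕ} {T T' : ℕ → Bool} (hp : p + 1 < m)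
    (h1 : T p = T (p + 1)) (h2 : T (p + 1) ≠ T (p + 2)) (h : ∀ i, i ≠ p + 1 → T' i = T i)
    (hT : T' (p + 1) ≠ T (p + 1)) :
    monochromaticWeight m T' < monochromaticWeight m T := by
  unfold monochromaticWeight
  have hs : ({p, p + 1} : Finset ℕ) ⊆ Finset.range m := by
    intro i
    simp only [Finset.mem_insert, Finset.mem_singleton, Finset.mem_range]
    lia
  rw [← Finset.sum_sdiff hs, ← Finset.sum_sdiff hs, Finset.sum_pair (by lia),
    Finset.sum_pair (by lia)]
  refine Nat.add_lt_add_of_le_of_lt (Finset.sum_le_sum fun i hi => ?_) ?_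
  · simp only [Finset.mem_sdiff, Finset.mem_insert, Finset.mem_singleton, not_or] at hi
    rw [h i hi.2.2, h (i + 1) (by lia)]
  · rw [if_pos h1, if_neg h2, h p (by lia), if_neg (by rw [h1]; exact hT.symm)]
    split_ifs <;> lia

/-- Every two-colouring of `{0, …, m}` with a monochromatic edge arises from the colouring by
parity by shifts that duplicate an end and by copying the colour of `p` to `p + 1` for inner
edges. -/
theorem coloring_induction {m : ℕ} {R : (ℕ → Bool) → Prop}
    (parity : ∀ T, (∀ i ≤ m, T i = decide (i % 2 = 1)) → R T)
    (left : ∀ T T', R T' → (∀ i < m, T i = T' (i + 1)) → T m = T' m → R T)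
    (right : ∀ T T', R T' → (∀ i < m, T (i + 1) = T' i) → T 0 = T' 0 → R T)
    (copy : ∀ T T' p, 1 ≤ p → p + 1 < m → R T' → (∀ i, i ≠ p + 1 → T i = T' i) →
      T (p + 1) = T' p → R T)
    (T : ℕ → Bool) (hT : ∃ i < m, T i = T (i + 1)) : R T := by
  have hnot : ∀ x y : Bool, x ≠ y → (!x) = y := by decide
  induction hw : monochromaticWeight m T using Nat.strong_induction_on generalizing T with
  | _ w ih =>
  subst hw
  have hm : 0 < m := by lia
  obtain ⟨k, rfl⟩ : ∃ k, m = k + 1 := ⟨m - 1, by lia⟩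
  by_cases h0 : T 0 = T 1
  · set S : Bool → ℕ → Bool := fun c i => if i < k + 1 then T (i + 1) else c with hS
    have hS1 : ∀ c, ∀ i < k + 1, S c i = T (i + 1) := fun c i hi => if_pos hi
    have hS2 : ∀ c, S c (k + 1) = c := fun c => if_neg (by lia)
    suffices h : ∃ c, R (S c) by
      obtain ⟨c, hc⟩ := h
      refine right T _ hc (fun i hi => (hS1 c i hi).symm) ?_
      rw [hS1 c 0 (by lia), h0]
    -- Shifting back to `T` forgets the end colour `c`, so it is free; this choice lowers the
    -- weight.
    by_cases h : ∃ i < k + 1, S (!T (k + 1)) i = S (!T (k + 1)) (i + 1)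
    · exact ⟨_, ih _ (monochromaticWeight_shift_left_lt hm h0 (hS1 _) (by simp [hS2])) _ h rfl⟩
    push Not at h
    rcases eq_decide_odd_or_even h with h | h
    · exact ⟨_, parity _ h⟩
    -- Here the lowered colouring is the forbidden alternating one; the other end colour gives a
    -- shift of the parity colouring.
    · refine ⟨T (k + 1), left _ (fun i => decide (i % 2 = 1)) (parity _ fun _ _ => rfl)
        (fun i hi => ?_) ?_⟩
      · rw [hS1 _ i hi, ← hS1 (!T (k + 1)) i hi, h i (by lia)]
        simp only [decide_eq_decide]
        lia
      · have := h (k + 1) le_rfl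
        rw [hS2] at this ⊢
        rw [← Bool.not_not (T (k + 1)), this, ← decide_not]
        simp only [decide_eq_decide]
        lia
  by_cases hk : T k = T (k + 1)
  · set S : Bool → ℕ → Bool := fun c i => if i = 0 then c else T (i - 1) with hS
    have hS1 : ∀ c, ∀ i, S c (i + 1) = T i := fun c i => if_neg (by lia)
    have hS2 : ∀ c, S c 0 = c := fun c => if_pos rfl
    suffices h : ∃ c, R (S c) by
      obtain ⟨c, hc⟩ := h
      refine left T _ hc (fun i hi => (hS1 c i).symm) ?_
      rw [hS1 c k, hk]
    by_cases h : ∃ i < k + 1, S (!T 0) i = S (!T 0) (i + 1)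
    · exact ⟨_, ih _ (monochromaticWeight_shift_right_lt hk (fun i _ => hS1 _ i)
        (by simp [hS2])) _ h rfl⟩
    push Not at h
    rcases eq_decide_odd_or_even h with h | h
    · exact ⟨_, parity _ h⟩
    · refine ⟨T 0, right _ (fun i => decide (i % 2 = 1)) (parity _ fun _ _ => rfl)
        (fun i hi => ?_) ?_⟩
      · rw [hS1 _ i, ← hS1 (!T 0) i, h (i + 1) (by lia)]
        simp only [decide_eq_decide]
        lia
      · have := h 0 (by lia)
        rw [hS2] at this ⊢
        rw [← Bool.not_not (T 0), this, ← decide_not]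
        simp
  -- Both end edges are bichromatic, so the last monochromatic edge is an inner one and can be
  -- pushed to the right.
  · obtain ⟨p, ⟨hp, hTp⟩, hmax⟩ : ∃ p, (p < k + 1 ∧ T p = T (p + 1)) ∧
        ∀ q, p < q → ¬ (q < k + 1 ∧ T q = T (q + 1)) := by
      classical
      obtain ⟨i, hi, hTi⟩ := hT
      refine ⟨Nat.findGreatest (fun q => q < k + 1 ∧ T q = T (q + 1)) (k + 1),
        Nat.findGreatest_spec (P := fun q => q < k + 1 ∧ T q = T (q + 1)) hi.le ⟨hi, hTi⟩,
        fun q hq hq' => Nat.findGreatest_is_greatest hq hq'.1.le hq'⟩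
    have hp1 : 1 ≤ p := by
      by_contra h
      obtain rfl : p = 0 := by lia
      exact h0 hTp
    have hpk : p + 1 < k + 1 := by
      by_contra h
      obtain rfl : p = k := by lia
      exact hk hTp
    have hne : T (p + 1) ≠ T (p + 2) := fun h => hmax (p + 1) (by lia) ⟨hpk, h⟩
    set S : ℕ → Bool := Function.update T (p + 1) (!T (p + 1)) with hS
    have hS1 : ∀ i, i ≠ p + 1 → S i = T i := fun i hi => Function.update_of_ne hi _ _
    have hS2 : S (p + 1) = !T (p + 1) := Function.update_self _ _ _
    refine copy T S p hp1 hpk (ih _ (monochromaticWeight_flip_lt hpk hTp hne hS1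
      (by simp [hS2])) S ⟨p + 1, hpk, ?_⟩ rfl) (fun i hi => (hS1 i hi).symm) ?_
    · rw [hS2, hS1 (p + 1 + 1) (by lia)]
      exact hnot _ _ hne
    · rw [hS1 p (by lia), hTp]

end Coloring

/-! ### Quotient complexities in terms of states. -/

namespace DFA

variable {α σ : Type*} (M : DFA α σ)

/-- The set of states from which the word `w` is accepted. -/
def acceptingStates (w : List α) : Set σ := {q | M.evalFrom q w ∈ M.accept}

theorem quotientComplexity_accepts (hstart : ∀ q, ∃ w, M.eval w = q)
    (hsep : ∀ p q, (∀ w, p ∈ M.acceptingStates w ↔ q ∈ M.acceptingStates w) → p = q) :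
    quotientComplexity M.accepts = (Set.univ : Set σ).encard := by
  have hinj : Function.Injective M.acceptsFrom := fun p q h =>
    hsep p q fun w => iff_of_eq (congrArg (w ∈ ·) h)
  have hsurj : Set.range M.eval = Set.univ := Set.range_eq_univ.2 hstart
  rw [quotientComplexity, Language.leftQuotient_accepts, Set.range_comp, hsurj,
    hinj.encard_image]

/-- The quotient by `w` consists of the `y` whose reversal leads from the start into
`M.acceptingStates w.reverse`; reachability makes it determine that set. -/
theorem quotientComplexity_reverse_accepts (hstart : ∀ q, ∃ w, M.eval w = q) :
    quotientComplexity M.accepts.reverse = (Set.range M.acceptingStates).encard := by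
  set F : Set σ → Language α := fun S => {y | M.eval y.reverse ∈ S}
  have hF : Function.Injective F := by
    intro S T h
    ext q
    obtain ⟨w, rfl⟩ := hstart q
    have : w.reverse ∈ F S ↔ w.reverse ∈ F T := by rw [h]
    change M.eval w.reverse.reverse ∈ S ↔ M.eval w.reverse.reverse ∈ T at this
    rwa [List.reverse_reverse] at this
  have : M.accepts.reverse.leftQuotient = F ∘ M.acceptingStates ∘ List.reverse := by
    funext w
    ext y
    change M.evalFrom M.start (w ++ y).reverse ∈ M.accept ↔
      M.evalFrom (M.evalFrom M.start y.reverse) w.reverse ∈ M.accept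
    rw [List.reverse_append, evalFrom_of_append]
  rw [quotientComplexity, this, Set.range_comp, hF.encard_image,
    List.reverse_surjective.range_comp]

end DFA

/-! ### The chain automaton and its sets of accepting states. -/

/-- The automaton of `reversalDFA`, defined for all `n ≥ 1`. -/
def chainDFA (n : ℕ) (hn : 1 ≤ n) : DFA (ReversalLetter n) (Set.Icc 1 n) where
  step i x :=
    match x with
    | .a => if h : i.1 = n then i else ⟨i.1 + 1, by have := i.2.1; have := i.2.2; grind⟩
    | .b => if h : i.1 = 1 then i else ⟨i.1 - 1, by have := i.2.1; have := i.2.2; grind⟩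
    | .c j h3 hj => if i.1 = j then ⟨j - 1, by grind⟩ else i
  start := ⟨1, by grind⟩
  accept := {i | Even i.1}

theorem chainDFA_eq_reversalDFA {n : ℕ} (hn : 3 ≤ n) :
    chainDFA n (by lia) = reversalDFA n hn := rfl

section Chain

variable {n : ℕ} (hn : 1 ≤ n)

theorem chainDFA_step_a (i : Set.Icc 1 n) :
    ((chainDFA n hn).step i .a).1 = if i.1 = n then i.1 else i.1 + 1 := by
  simp only [chainDFA]
  split_ifs <;> rfl

theorem chainDFA_step_b (i : Set.Icc 1 n) :
    ((chainDFA n hn).step i .b).1 = if i.1 = 1 then i.1 else i.1 - 1 := by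
  simp only [chainDFA]
  split_ifs <;> rfl

theorem chainDFA_step_c (i : Set.Icc 1 n) {j : ℕ} (h3 : 3 ≤ j) (hj : j ≤ n - 1) :
    ((chainDFA n hn).step i (.c j h3 hj)).1 = if i.1 = j then j - 1 else i.1 := by
  simp only [chainDFA]
  split_ifs <;> rfl

theorem chainDFA_step_monotone (x : ReversalLetter n) :
    Monotone fun i => (chainDFA n hn).step i x := by
  intro i k hik
  have h1 := i.2
  have h2 := k.2
  have h : i.1 ≤ k.1 := hik
  rw [Set.mem_Icc] at h1 h2
  change ((chainDFA n hn).step i x).1 ≤ ((chainDFA n hn).step k x).1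
  cases x with
  | a =>
    rw [chainDFA_step_a, chainDFA_step_a]
    split_ifs <;> lia
  | b =>
    rw [chainDFA_step_b, chainDFA_step_b]
    split_ifs <;> lia
  | c j h3 hj =>
    rw [chainDFA_step_c, chainDFA_step_c]
    split_ifs <;> lia

theorem chainDFA_exists_eval_eq (q : Set.Icc 1 n) : ∃ w, (chainDFA n hn).eval w = q := by
  obtain ⟨q, h1, h2⟩ := q
  induction q, h1 using Nat.le_induction with
  | base => exact ⟨[], rfl⟩
  | succ q hq ih =>
    obtain ⟨w, hw⟩ := ih (by lia)
    refine ⟨w ++ [.a], Subtype.ext ?_⟩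
    rw [DFA.eval_append_singleton, hw, chainDFA_step_a, if_neg (by grind)]

theorem chainDFA_evalFrom_mono (w : List (ReversalLetter n)) :
    ∀ {i k : Set.Icc 1 n}, i ≤ k →
      (chainDFA n hn).evalFrom i w ≤ (chainDFA n hn).evalFrom k w := by
  induction w with
  | nil => exact fun h => h
  | cons x w ih => exact fun h => ih (chainDFA_step_monotone hn x h)

/-- Along a monotone map the parities alternate at most as often as along the chain. -/
theorem chainDFA_acceptingStates_ne (w : List (ReversalLetter n)) :
    (chainDFA n hn).acceptingStates w ≠ {i | Odd i.1} := by
  intro h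
  have hodd : ∀ i : Set.Icc 1 n, Even ((chainDFA n hn).evalFrom i w).1 ↔ Odd i.1 := fun i =>
    iff_of_eq (congrArg (i ∈ ·) h)
  -- The image of `i + 1` is at least that of `i`, hence at least `i + 1`, and parity excludes
  -- equality. At `i = n` this is absurd.
  have key : ∀ i (hi : 1 ≤ i ∧ i ≤ n), i < ((chainDFA n hn).evalFrom ⟨i, hi⟩ w).1 := by
    rintro i ⟨h1, h2⟩
    induction i, h1 using Nat.le_induction with
    | base =>
      have h3 := (hodd ⟨1, le_rfl, hn⟩).2 odd_one
      have h4 := ((chainDFA n hn).evalFrom ⟨1, le_rfl, hn⟩ w).2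
      rw [Set.mem_Icc] at h4
      grind
    | succ i hi ih =>
      have h3 := ih (by lia)
      have h4 : ((chainDFA n hn).evalFrom ⟨i, hi, by lia⟩ w).1 ≤
          ((chainDFA n hn).evalFrom ⟨i + 1, by lia, h2⟩ w).1 :=
        chainDFA_evalFrom_mono hn w (Subtype.mk_le_mk.2 (Nat.le_succ i))
      have h5 := hodd ⟨i, hi, by lia⟩
      have h6 := hodd ⟨i + 1, by lia, h2⟩
      simp only at h5 h6
      grind
  have := key n ⟨hn, le_rfl⟩
  have h4 := ((chainDFA n hn).evalFrom ⟨n, hn, le_rfl⟩ w).2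
  rw [Set.mem_Icc] at h4
  lia

theorem chainDFA_range_acceptingStates :
    Set.range (chainDFA n hn).acceptingStates = {S | S ≠ {i | Odd i.1}} := by
  classical
  apply Set.Subset.antisymm
  · rintro _ ⟨w, rfl⟩
    exact chainDFA_acceptingStates_ne hn w
  obtain ⟨m, rfl⟩ : ∃ m, n = m + 1 := ⟨n - 1, by lia⟩
  intro S hS
  -- Vertex `i` of the path stands for state `i + 1`, so the empty word gives the parity colouring.
  set R : (ℕ → Bool) → Prop := fun T => ∃ w, ∀ i (hi : i ≤ m),
    T i = true ↔ (⟨i + 1, by lia, by lia⟩ : Set.Icc 1 (m + 1)) ∈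
      (chainDFA (m + 1) hn).acceptingStates w with hR
  have hcons : ∀ x w (q q' : Set.Icc 1 (m + 1)), ((chainDFA (m + 1) hn).step q x).1 = q'.1 →
      (q ∈ (chainDFA (m + 1) hn).acceptingStates (x :: w) ↔
        q' ∈ (chainDFA (m + 1) hn).acceptingStates w) := by
    intro x w q q' h
    obtain rfl := Subtype.ext h
    rfl
  have parity : ∀ T, (∀ i ≤ m, T i = decide (i % 2 = 1)) → R T := by
    intro T hT
    refine ⟨[], fun i hi => ?_⟩
    rw [hT i hi, decide_eq_true_iff]
    change _ ↔ Even (i + 1)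
    rw [Nat.even_iff]
    lia
  set T : ℕ → Bool := fun i => decide (∃ h : i ≤ m,
    (⟨i + 1, by lia, by lia⟩ : Set.Icc 1 (m + 1)) ∈ S) with hT
  have hTS : ∀ i (hi : i ≤ m), T i = true ↔
      (⟨i + 1, by lia, by lia⟩ : Set.Icc 1 (m + 1)) ∈ S := fun i hi => by
    simp [hT, hi]
  suffices h : R T by
    obtain ⟨w, hw⟩ := h
    refine ⟨w, ?_⟩
    ext ⟨q, h1, h2⟩
    obtain ⟨i, rfl⟩ : ∃ i, q = i + 1 := ⟨q - 1, by lia⟩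
    rw [← hTS i (by lia), hw i (by lia)]
  by_cases hmono : ∃ i < m, T i = T (i + 1)
  · refine coloring_induction parity ?_ ?_ ?_ T hmono
    · rintro T T' ⟨w, hw⟩ h1 h2
      refine ⟨.a :: w, fun i hi => ?_⟩
      rcases hi.lt_or_eq with hi | rfl
      · rw [h1 i hi, hw (i + 1) hi]
        refine (hcons _ _ _ _ ?_).symm
        rw [chainDFA_step_a, if_neg (by grind)]
      · rw [h2, hw _ le_rfl]
        refine (hcons _ _ _ _ ?_).symm
        rw [chainDFA_step_a, if_pos rfl]
    · rintro T T' ⟨w, hw⟩ h1 h2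
      refine ⟨.b :: w, fun i hi => ?_⟩
      cases i with
      | zero =>
        rw [h2, hw _ hi]
        refine (hcons _ _ _ _ ?_).symm
        rw [chainDFA_step_b, if_pos rfl]
      | succ i =>
        rw [h1 i hi, hw i (by lia)]
        refine (hcons _ _ _ _ ?_).symm
        rw [chainDFA_step_b, if_neg (by grind)]
        rfl
    · rintro T T' p hp1 hp ⟨w, hw⟩ h1 h2
      refine ⟨.c (p + 2) (by lia) (by lia) :: w, fun i hi => ?_⟩
      by_cases hip : i = p + 1
      · subst hip
        rw [h2, hw p (by lia)]
        refine (hcons _ _ _ _ ?_).symm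
        rw [chainDFA_step_c, if_pos rfl]
        rfl
      · rw [h1 i hip, hw i hi]
        refine (hcons _ _ _ _ ?_).symm
        rw [chainDFA_step_c, if_neg (by grind)]
  · push Not at hmono
    rcases eq_decide_odd_or_even hmono with h | h
    · exact parity T h
    · refine absurd ?_ hS
      ext ⟨q, h1, h2⟩
      obtain ⟨i, rfl⟩ : ∃ i, q = i + 1 := ⟨q - 1, by lia⟩
      rw [← hTS i (by lia), h i (by lia), decide_eq_true_iff]
      change _ ↔ Odd (i + 1)
      rw [Nat.odd_iff]
      lia

theorem encard_setOf_ne {σ : Type*} [Fintype σ] (S : Set σ) :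
    {T : Set σ | T ≠ S}.encard = (2 ^ Fintype.card σ - 1 : ℕ) := by
  classical
  have : {T : Set σ | T ≠ S} = ↑({S}ᶜ : Finset (Set σ)) := by
    ext
    simp
  rw [this, Set.encard_coe_eq_coe_finsetCard, Finset.card_compl, Finset.card_singleton,
    Fintype.card_set]

theorem chainDFA_comap_spec {α : Type*} [Finite α] {g : α → ReversalLetter n}
    (hg : Function.Surjective g) :
    IsStarFree ((chainDFA n hn).comap g).accepts ∧
      quotientComplexity ((chainDFA n hn).comap g).accepts = n ∧
      quotientComplexity ((chainDFA n hn).comap g).accepts.reverse = (2 ^ n - 1 : ℕ) := by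
  have hmap : Function.Surjective (List.map g) := List.map_surjective_iff.2 hg
  have hstart : ∀ q, ∃ w, ((chainDFA n hn).comap g).eval w = q := by
    intro q
    obtain ⟨w, hw⟩ := chainDFA_exists_eval_eq hn q
    obtain ⟨v, rfl⟩ := hmap w
    exact ⟨v, by rw [DFA.eval_comap, hw]⟩
  have hrange : Set.range ((chainDFA n hn).comap g).acceptingStates =
      {S | S ≠ {i | Odd i.1}} := by
    rw [← chainDFA_range_acceptingStates hn, ← hmap.range_comp]
    congr 1
    funext w
    simp only [DFA.acceptingStates, DFA.evalFrom_comap, Function.comp_apply]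
    rfl
  have hcard : Fintype.card (Set.Icc 1 n) = n := by simp
  refine ⟨DFA.isStarFree_accepts_of_monotone hn _ fun x => chainDFA_step_monotone hn (g x),
    ?_, ?_⟩
  · rw [DFA.quotientComplexity_accepts _ hstart, Set.encard_univ, ENat.card_eq_coe_fintype_card,
      hcard]
    intro p q h
    have key : ∀ S : Set (Set.Icc 1 n), S ≠ {i | Odd i.1} → (p ∈ S ↔ q ∈ S) := by
      intro S hS
      obtain ⟨w, rfl⟩ : S ∈ Set.range ((chainDFA n hn).comap g).acceptingStates := hrange ▸ hS
      exact h w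
    by_contra hpq
    -- At most one of the singletons `{p}`, `{q}` is the missing set; the other separates the
    -- states.
    by_cases hp : ({p} : Set (Set.Icc 1 n)) = {i | Odd i.1}
    · have hq : ({q} : Set (Set.Icc 1 n)) ≠ {i | Odd i.1} := by
        rw [← hp]
        exact fun h' => hpq (Set.singleton_injective h').symm
      exact hpq ((key _ hq).2 rfl)
    · exact hpq ((key _ hp).1 rfl).symm
  · rw [DFA.quotientComplexity_reverse_accepts _ hstart, hrange, encard_setOf_ne, hcard]

end Chain

/-! ### Alphabet sizes and the conclusion. -/

/-- The letters `a`, `b` and the indices of the letters `c_j`. -/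
def reversalLetterEquiv (n : ℕ) : ReversalLetter n ≃ Bool ⊕ Finset.Icc 3 (n - 1) where
  toFun
    | .a => .inl true
    | .b => .inl false
    | .c j h3 hj => .inr ⟨j, Finset.mem_Icc.2 ⟨h3, hj⟩⟩
  invFun
    | .inl true => .a
    | .inl false => .b
    | .inr j => .c j.1 (Finset.mem_Icc.1 j.2).1 (Finset.mem_Icc.1 j.2).2
  left_inv x := by cases x <;> rfl
  right_inv x := by rcases x with (_ | _) | _ <;> rfl

theorem natCard_reversalLetter {n : ℕ} (hn : 3 ≤ n) : Nat.card (ReversalLetter n) = n - 1 := by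
  rw [Nat.card_congr (reversalLetterEquiv n), Nat.card_eq_fintype_card]
  simp only [Fintype.card_sum, Fintype.card_bool, Fintype.card_coe, Nat.card_Icc]
  lia

theorem exists_surjective_reversalLetter {n : ℕ} (α : Type*) [Fintype α]
    (h2 : 2 ≤ Fintype.card α) (hn : n - 1 ≤ Fintype.card α) :
    ∃ g : α → ReversalLetter n, Function.Surjective g := by
  have hcard : Fintype.card (Bool ⊕ Finset.Icc 3 (n - 1)) ≤ Fintype.card α := by
    simp only [Fintype.card_sum, Fintype.card_bool, Fintype.card_coe, Nat.card_Icc]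
    lia
  obtain ⟨e⟩ := Function.Embedding.nonempty_of_card_le hcard
  exact ⟨_, (reversalLetterEquiv n).symm.surjective.comp (Function.invFun_surjective e.injective)⟩

theorem quotientComplexity_zero {α : Type*} : quotientComplexity (0 : Language α) = 1 := by
  have : Language.leftQuotient (0 : Language α) = fun _ => 0 := rfl
  rw [quotientComplexity, this, Set.range_const, Set.encard_singleton]

theorem theorem5 (n : ℕ) (hn : 1 ≤ n) :
    (∀ (α : Type*) [Fintype α],
      (n = 1 → 1 ≤ Fintype.card α) → (n = 2 → 2 ≤ Fintype.card α) →
      (3 ≤ n → n - 1 ≤ Fintype.card α) →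
      ∃ L : Language α, IsStarFree L ∧ quotientComplexity L = n ∧
        quotientComplexity L.reverse = (2 ^ n - 1 : ℕ)) ∧
    (∀ h : 3 ≤ n,
      Nat.card (ReversalLetter n) = n - 1 ∧
      IsStarFree (reversalDFA n h).accepts ∧
      quotientComplexity (reversalDFA n h).accepts = n ∧
      quotientComplexity (reversalDFA n h).accepts.reverse = (2 ^ n - 1 : ℕ)) := by
  refine ⟨fun α _ _ h2 h3 => ?_, fun h => ⟨natCard_reversalLetter h, ?_⟩⟩
  · rcases hn.eq_or_lt with rfl | hn'
    -- The chain alphabet always contains both `a` and `b`, too many for a one-letter `α`; the empty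
    -- language serves instead.
    · refine ⟨0, IsStarFree.empty, ?_, ?_⟩
      · simpa using quotientComplexity_zero
      · rw [Language.reverse_zero]
        simpa using quotientComplexity_zero
    · obtain ⟨g, hg⟩ := exists_surjective_reversalLetter (n := n) α (by lia) (by lia)
      exact ⟨_, chainDFA_comap_spec hn hg⟩
  · have : Finite (ReversalLetter n) := Finite.of_equiv _ (reversalLetterEquiv n).symm
    rw [← chainDFA_eq_reversalDFA h]
    exact chainDFA_comap_spec hn (g := id) Function.surjective_id
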